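/- Let $V_4=\{0<a<b<1\}$ be the four-element chain with Gödel implication $x\Rightarrow_G y=1$ if $x\le y$ and $x\Rightarrow_G y=y$ if $x>y$. For $n\ge 1$ consider all full bracketings of $p_1\Rightarrow p_2\Rightarrow\cdots\Rightarrow p_n$ in $n$ distinct variables, each evaluated under all $4^n$ valuations $\{p_1,\dots,p_n\}\to V_4$. Let $f_n,a_n,b_n,t_n$ be the total numbers of pairs (bracketing, valuation) whose value is $0,a,b,1$ respectively, and let $g_n=f_n+a_n+b_n+t_n$. Put $$\beta=\sqrt{7+2\sqrt2},\qquad \alpha=1+\sqrt2+\beta,\qquad \gamma=\sqrt{16+\alpha^2},$$ $$p_\bot=\frac12-\frac{\sqrt2}{4},\qquad p_a=\frac{2+\sqrt2}{2\alpha\beta},\qquad p_b=\frac{(2+\sqrt2)\,\alpha}{\beta\gamma(\alpha+\gamma)},\qquad p_\top=\frac{(2+\sqrt2)\,\alpha(\alpha+\gamma)}{16\,\beta\gamma}.$$ Then $g_n=4^n C_{n-1}$ for all $n\ge1$, where $C_k=\frac1{k+1}\binom{2k}{k}$ is the $k$-th Catalan number, and, as $n\to\infty$, $$g_n\sim\frac{16^n}{4\sqrt\pi\,n^{3/2}}.$$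 The constants above are the limiting proportions $$p_\bot=\lim_{n\to\infty}\frac{f_n}{g_n},\qquad p_a=\lim_{n\to\infty}\frac{a_n}{g_n},\qquad p_b=\lim_{n\to\infty}\frac{b_n}{g_n},\qquad p_\top=\lim_{n\to\infty}\frac{t_n}{g_n}$$ (in particular these limits exist), and each component satisfies $$f_n\sim \frac{p_\bot}{4}\,\frac{16^n}{\sqrt\pi\,n^{3/2}},\qquad a_n\sim \frac{p_a}{4}\,\frac{16^n}{\sqrt\pi\,n^{3/2}},\qquad b_n\sim \frac{p_b}{4}\,\frac{16^n}{\sqrt\pi\,n^{3/2}},\qquad t_n\sim \frac{p_\top}{4}\,\frac{16^n}{\sqrt\pi\,n^{3/2}}.$$ -/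

import Mathlib

open Filter Asymptotics

namespace Godel4

/-- The four-element chain of truth values `0 < a < b < 1`, with the order of `Fin 4`. -/
abbrev V4 : Type := Fin 4

/-- The least truth value `0`. -/
abbrev V4.bot : V4 := 0

/-- The truth value `a`. -/
abbrev V4.a : V4 := 1

/-- The truth value `b`. -/
abbrev V4.b : V4 := 2

/-- The greatest truth value, written `1` in the chain `0 < a < b < 1`. -/
abbrev V4.top : V4 := 3

/-- Gödel implication: `x ⇒ y` is the top value if `x ≤ y`, and `y` if `x > y`. -/
def godelImp (x y : V4) : V4 := if x ≤ y then V4.top else y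

/-- Propositional formulae built from variables in `α` by implication alone. -/
inductive Formula (α : Type) : Type
  | var : α → Formula α
  | imp : Formula α → Formula α → Formula α

/-- The variables of a formula, listed from left to right with multiplicity. -/
def Formula.vars {α : Type} : Formula α → List α
  | .var p => [p]
  | .imp φ ψ => φ.vars ++ ψ.vars

/-- The truth value of a formula under a valuation `ν` of its variables. -/
def Formula.eval {α : Type} (ν : α → V4) : Formula α → V4
  | .var p => ν p
  | .imp φ ψ => godelImp (φ.eval ν) (ψ.eval ν)

/-- The fully bracketed implications `p₁ ⇒ p₂ ⇒ ⋯ ⇒ pₙ`: the formulae in which the `n` distinct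
variables occur once each, in their natural order. -/
def bracketings (n : ℕ) : Set (Formula (Fin n)) :=
  {φ | φ.vars = List.finRange n}

/-- The number of rows (pairs of a bracketing on `n` variables and a valuation of the variables)
whose output is `v`. -/
noncomputable def count (v : V4) (n : ℕ) : ℕ :=
  Set.ncard {r : Formula (Fin n) × (Fin n → V4) | r.1 ∈ bracketings n ∧ r.1.eval r.2 = v}

/-- The number of outputs `0`. -/
noncomputable def f (n : ℕ) : ℕ := count V4.bot n

/-- The number of outputs `a`. -/
noncomputable def a (n : ℕ) : ℕ := count V4.a n

/-- The number of outputs `b`. -/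
noncomputable def b (n : ℕ) : ℕ := count V4.b n

/-- The number of outputs `1`. -/
noncomputable def t (n : ℕ) : ℕ := count V4.top n

/-- The total number of outputs. -/
noncomputable def g (n : ℕ) : ℕ := f n + a n + b n + t n

/-- `β = √(7 + 2√2)`. -/
noncomputable def β : ℝ := √(7 + 2 * √2)

/-- `α = 1 + √2 + β`. -/
noncomputable def α : ℝ := 1 + √2 + β

/-- `γ = √(16 + α²)`. -/
noncomputable def γ : ℝ := √(16 + α ^ 2)

/-- The limiting proportion of the output `0`. -/
noncomputable def pBot : ℝ := 1 / 2 - √2 / 4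

/-- The limiting proportion of the output `a`. -/
noncomputable def pA : ℝ := (2 + √2) / (2 * α * β)

/-- The limiting proportion of the output `b`. -/
noncomputable def pB : ℝ := (2 + √2) * α / (β * γ * (α + γ))

/-- The limiting proportion of the output `1`. -/
noncomputable def pTop : ℝ := (2 + √2) * α * (α + γ) / (16 * β * γ)

end Godel4

/-! Substituting the valuation into the leaves turns each pair into a binary tree with leaves
labelled in `V4`. Splitting at the root, an implication takes a value below the top exactly when its
conclusion has that value and its premise a larger one. From index 2 on this gives `f = (a + b + t)
* f`, `a = (b + t) * a`, `b = t * b` as convolutions, and `g = g * g`, the Catalan recurrence. Scale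
by `16 ^ n`. Let `h` be the scaled `g`, of total mass 1/2, with asymptotics from Wallis' product.
Each equation reads `u = (w - u) * u` with `w` already known: if `w` has sum `W` and `w / h → ω`,
the sum `r` of `u` is the positive root of `r ^ 2 + (1 - W) r = 1 / 16`, and the limit `L` of `u /
h` must satisfy `L = (W - 2 r) L + r ω`. Existence of `L` needs no singularity analysis: the
deviation of `u / h` from `L` contracts by 1/2 up to a null sequence (`SlowWeight.tendsto_of_conv`).
Peeling off `f`, `a`, `b` in turn (`tendsto_scaled_of_conv`) leaves `t`. -/

namespace Godel4

/-! ### Valuations as leaf labels -/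

/-- Relabel the variables of a formula. -/
def Formula.map {α β : Type} (h : α → β) : Formula α → Formula β
  | .var p => .var (h p)
  | .imp φ ψ => .imp (φ.map h) (ψ.map h)

namespace Formula

variable {α β : Type}

theorem vars_map (h : α → β) (φ : Formula α) : (φ.map h).vars = φ.vars.map h := by
  induction φ with
  | var p => rfl
  | imp φ ψ h₁ h₂ => simp [map, vars, h₁, h₂]

theorem eval_map (h : α → β) (ν : β → V4) (φ : Formula α) :
    (φ.map h).eval ν = φ.eval (ν ∘ h) := by
  induction φ with
  | var p => rfl
  | imp φ ψ h₁ h₂ => simp [map, eval, h₁, h₂]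

theorem length_vars_pos (φ : Formula α) : 0 < φ.vars.length := by
  induction φ with
  | var p => simp [vars]
  | imp φ ψ h₁ h₂ => simp only [vars, List.length_append]; omega

/-- A formula is determined by its relabelled shape and its list of variables. -/
theorem ext_of_map_of_vars (h h' : α → β) (φ ψ : Formula α) (hm : φ.map h = ψ.map h')
    (hv : φ.vars = ψ.vars) : φ = ψ := by
  induction φ generalizing ψ with
  | var p =>
    cases ψ with
    | var q => simpa [vars] using hv
    | imp ψ₁ ψ₂ => simp [map] at hm
  | imp φ₁ φ₂ h₁ h₂ =>
    cases ψ with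
    | var q => simp [map] at hm
    | imp ψ₁ ψ₂ =>
      simp only [map, imp.injEq] at hm
      have hl : φ₁.vars.length = ψ₁.vars.length := by
        have := congrArg (fun χ => χ.vars.length) hm.1
        simpa [vars_map] using this
      simp only [vars] at hv
      obtain ⟨e₁, e₂⟩ := List.append_inj hv hl
      rw [h₁ ψ₁ hm.1 e₁, h₂ ψ₂ hm.2 e₂]

/-- Every formula is a relabelling of one with any prescribed list of variables of the right length
that maps onto its own. -/
theorem exists_map_eq (h : α → β) (ψ : Formula β) (l : List α) (hl : l.map h = ψ.vars) :
    ∃ φ : Formula α, φ.map h = ψ ∧ φ.vars = l := by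
  induction ψ generalizing l with
  | var q =>
    obtain ⟨p, rfl, hp⟩ := List.map_eq_singleton_iff.1 hl
    exact ⟨.var p, by simp [map, hp], rfl⟩
  | imp ψ₁ ψ₂ h₁ h₂ =>
    obtain ⟨l₁, l₂, rfl, e₁, e₂⟩ := List.map_eq_append_iff.1 hl
    obtain ⟨φ₁, m₁, v₁⟩ := h₁ l₁ e₁
    obtain ⟨φ₂, m₂, v₂⟩ := h₂ l₂ e₂
    exact ⟨.imp φ₁ φ₂, by simp [map, m₁, m₂], by simp [vars, v₁, v₂]⟩

end Formula

/-- The closed implications with `n` leaves labelled by truth values and value `v`. -/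
def labelled (v : V4) (n : ℕ) : Set (Formula V4) :=
  {ψ | ψ.vars.length = n ∧ ψ.eval id = v}

/-- The variables are distinct and in fixed order, so the leaf labels determine the valuation and
the shape determines the bracketing. -/
theorem count_eq_ncard_labelled (v : V4) (n : ℕ) : count v n = (labelled v n).ncard := by
  refine Set.ncard_congr (fun r _ => r.1.map r.2) ?_ ?_ ?_
  · rintro ⟨φ, ν⟩ ⟨hb, he⟩
    simp only [bracketings, Set.mem_ofPred_eq] at hb he
    exact ⟨by simp [Formula.vars_map, hb], by simp [Formula.eval_map, he]⟩
  · rintro ⟨φ, ν⟩ ⟨φ', ν'⟩ ⟨hb, -⟩ ⟨hb', -⟩ hm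
    simp only [bracketings, Set.mem_ofPred_eq] at hb hb' hm
    have hν : ν = ν' := by
      have := congrArg Formula.vars hm
      rw [Formula.vars_map, Formula.vars_map, hb, hb', List.map_inj_left] at this
      exact funext fun i => this i (List.mem_finRange i)
    rw [Formula.ext_of_map_of_vars ν ν' φ φ' hm (hb.trans hb'.symm), hν]
  · rintro ψ ⟨hl, he⟩
    -- The valuation reads off the label of the `i`-th leaf.
    obtain ⟨φ, hm, hv⟩ := Formula.exists_map_eq (fun i : Fin n => ψ.vars.get (i.cast hl.symm)) ψ
      (List.finRange n) (by subst hl; simp)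
    refine ⟨(φ, _), ⟨hv, ?_⟩, hm⟩
    have e := Formula.eval_map (fun i : Fin n => ψ.vars.get (i.cast hl.symm)) id φ
    rw [hm] at e
    exact e.symm.trans he

theorem finite_setOf_length_vars_le (n : ℕ) : {ψ : Formula V4 | ψ.vars.length ≤ n}.Finite := by
  induction n with
  | zero =>
    convert Set.finite_empty (α := Formula V4)
    ext ψ
    simpa using (List.length_pos_iff.1 ψ.length_vars_pos)
  | succ n ih =>
    refine ((Set.finite_range (Formula.var (α := V4))).union
      (Set.Finite.image2 Formula.imp ih ih)).subset ?_
    rintro (p | ⟨φ, ψ⟩) h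
    · exact Or.inl ⟨p, rfl⟩
    · simp only [Set.mem_ofPred_eq, Formula.vars, List.length_append] at h
      have := φ.length_vars_pos
      have := ψ.length_vars_pos
      exact Or.inr ⟨φ, by simp only [Set.mem_ofPred_eq]; omega, ψ,
        by simp only [Set.mem_ofPred_eq]; omega, rfl⟩

theorem finite_labelled (v : V4) (n : ℕ) : (labelled v n).Finite :=
  (finite_setOf_length_vars_le n).subset fun _ h => h.1.le

/-! ### Initial values and convolution recurrences -/

theorem count_zero (v : V4) : count v 0 = 0 := by
  rw [count_eq_ncard_labelled, Set.ncard_eq_zero (finite_labelled v 0), Set.eq_empty_iff_forall_notMem]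
  rintro ψ ⟨h, -⟩
  exact ψ.length_vars_pos.ne' h

theorem count_one (v : V4) : count v 1 = 1 := by
  rw [count_eq_ncard_labelled, Set.ncard_eq_one]
  refine ⟨.var v, Set.ext ?_⟩
  rintro (p | ⟨φ, ψ⟩)
  · simp [labelled, Formula.vars, Formula.eval]
  · have := φ.length_vars_pos
    have := ψ.length_vars_pos
    simp only [labelled, Formula.vars, List.length_append, Set.mem_ofPred_eq,
      Set.mem_singleton_iff, reduceCtorEq, iff_false]
    omega

-- Decomposition at the root; `2 ≤ n` excludes single leaves.
open Finset in
theorem count_eq_sum (v : V4) {n : ℕ} (hn : 2 ≤ n) :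
    count v n = ∑ p ∈ antidiagonal n, ∑ x : V4, ∑ y : V4,
      if godelImp x y = v then count x p.1 * count y p.2 else 0 := by
  have hT : ∀ v n, count v n = #(finite_labelled v n).toFinset := fun v n => by
    rw [count_eq_ncard_labelled, Set.ncard_eq_toFinset_card _ (finite_labelled v n)]
  have hR : (∑ p ∈ antidiagonal n, ∑ x : V4, ∑ y : V4,
      if godelImp x y = v then count x p.1 * count y p.2 else 0) =
      #((antidiagonal n).sigma fun p => (univ.filter fun q : V4 × V4 => godelImp q.1 q.2 = v).sigma
        fun q => (finite_labelled q.1 p.1).toFinset ×ˢ (finite_labelled q.2 p.2).toFinset) := by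
    simp only [card_sigma, card_product, hT, sum_filter, Fintype.sum_prod_type]
  rw [hR, hT]
  symm
  refine Finset.card_bij (fun s _ => .imp s.2.2.1 s.2.2.2) ?_ ?_ ?_
  · rintro ⟨⟨i, j⟩, ⟨x, y⟩, φ, ψ⟩ h
    simp only [mem_sigma, HasAntidiagonal.mem_antidiagonal, mem_filter, mem_univ, true_and, mem_product,
      Set.Finite.mem_toFinset, labelled, Set.mem_ofPred_eq] at h ⊢
    obtain ⟨rfl, rfl, ⟨rfl, rfl⟩, rfl, rfl⟩ := h
    simp [Formula.vars, Formula.eval]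
  · rintro ⟨⟨i, j⟩, ⟨x, y⟩, φ, ψ⟩ h ⟨⟨i', j'⟩, ⟨x', y'⟩, φ', ψ'⟩ h' e
    simp only [mem_sigma, HasAntidiagonal.mem_antidiagonal, mem_filter, mem_univ, true_and, mem_product,
      Set.Finite.mem_toFinset, labelled, Set.mem_ofPred_eq, Formula.imp.injEq] at h h' e
    obtain ⟨rfl, rfl⟩ := e
    obtain ⟨-, -, ⟨rfl, rfl⟩, rfl, rfl⟩ := h
    obtain ⟨-, -, ⟨rfl, rfl⟩, rfl, rfl⟩ := h'
    rfl
  · rintro (p | ⟨φ, ψ⟩) h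
    · simp only [Set.Finite.mem_toFinset, labelled, Set.mem_ofPred_eq, Formula.vars,
        List.length_singleton] at h
      omega
    · simp only [Set.Finite.mem_toFinset, labelled, Set.mem_ofPred_eq, Formula.vars,
        List.length_append] at h
      exact ⟨⟨(φ.vars.length, ψ.vars.length), (φ.eval id, ψ.eval id), φ, ψ⟩, by
        simpa [labelled, Formula.eval] using h, rfl⟩

open Finset in
theorem f_eq_sum {n : ℕ} (hn : 2 ≤ n) :
    f n = ∑ p ∈ antidiagonal n, (a p.1 + b p.1 + t p.1) * f p.2 := by
  rw [f, count_eq_sum _ hn]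
  refine sum_congr rfl fun p _ => ?_
  simp [Fin.sum_univ_four, godelImp, V4.bot, V4.a, V4.b, V4.top, f, a, b, t]
  ring

open Finset in
theorem a_eq_sum {n : ℕ} (hn : 2 ≤ n) :
    a n = ∑ p ∈ antidiagonal n, (b p.1 + t p.1) * a p.2 := by
  rw [a, count_eq_sum _ hn]
  refine sum_congr rfl fun p _ => ?_
  simp [Fin.sum_univ_four, godelImp, V4.a, V4.b, V4.top, a, b, t]
  ring

open Finset in
theorem b_eq_sum {n : ℕ} (hn : 2 ≤ n) :
    b n = ∑ p ∈ antidiagonal n, t p.1 * b p.2 := by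
  rw [b, count_eq_sum _ hn]
  refine sum_congr rfl fun p _ => ?_
  simp [Fin.sum_univ_four, godelImp, V4.b, V4.top, b, t]

open Finset in
theorem g_eq_sum {n : ℕ} (hn : 2 ≤ n) :
    g n = ∑ p ∈ antidiagonal n, g p.1 * g p.2 := by
  rw [g, f, a, b, t, count_eq_sum _ hn, count_eq_sum _ hn, count_eq_sum _ hn, count_eq_sum _ hn,
    ← sum_add_distrib, ← sum_add_distrib, ← sum_add_distrib]
  refine sum_congr rfl fun p _ => ?_
  simp [Fin.sum_univ_four, godelImp, V4.bot, V4.a, V4.b, V4.top, g, f, a, b, t]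
  ring

theorem g_zero : g 0 = 0 := by simp [g, f, a, b, t, count_zero]

theorem g_one : g 1 = 4 := by simp [g, f, a, b, t, count_one]

open Finset in
theorem g_succ (n : ℕ) : g (n + 1) = 4 ^ (n + 1) * catalan n := by
  induction n using Nat.strong_induction_on with
  | _ n ih =>
    rcases n with _ | n
    · simp [g_one]
    -- Both end terms vanish because `g 0 = 0`; what remains is Segner's recurrence.
    · rw [g_eq_sum (by omega), Nat.sum_antidiagonal_succ, Nat.sum_antidiagonal_succ']
      simp only [g_zero, zero_mul, mul_zero, zero_add, catalan_succ']
      rw [mul_sum]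
      refine sum_congr rfl fun p hp => ?_
      have hp' := HasAntidiagonal.mem_antidiagonal.1 hp
      rw [ih p.1 (by omega), ih p.2 (by omega), ← hp']
      ring

theorem g_eq_catalan {n : ℕ} (hn : 1 ≤ n) : g n = 4 ^ n * catalan (n - 1) := by
  obtain ⟨m, rfl⟩ := Nat.exists_eq_add_of_le' hn
  exact g_succ m

end Godel4

/-! ### Asymptotics of convolution equations -/

namespace Godel4

open Finset Topology

/-- A nonnegative summable weight, vanishing at `0`, with slowly varying terms and dominating its
own convolution square from index `2` on. -/
structure SlowWeight (h : ℕ → ℝ) : Prop where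
  zero : h 0 = 0
  pos : ∀ n, 1 ≤ n → 0 < h n
  summable : Summable h
  ratio : Tendsto (fun n => h (n + 1) / h n) atTop (𝓝 1)
  doubling : ∃ K, ∀ i n, 2 * i ≤ n → h (n - i) ≤ K * h n
  conv_le : ∀ n, 2 ≤ n → ∑ p ∈ antidiagonal n, h p.1 * h p.2 ≤ h n

/-- The part of the convolution of `u` and `v` in which the index of `u` is the smaller one. -/
def halfConv (u v : ℕ → ℝ) (n : ℕ) : ℝ := ∑ i ∈ range ((n + 1) / 2), u i * v (n - i)

/-- The diagonal term of the convolution of `u` and `v`. -/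
def diagConv (u v : ℕ → ℝ) (n : ℕ) : ℝ := if Even n then u (n / 2) * v (n / 2) else 0

theorem sum_antidiagonal_eq_halfConv (u v : ℕ → ℝ) (n : ℕ) :
    ∑ p ∈ antidiagonal n, u p.1 * v p.2 = halfConv u v n + halfConv v u n + diagConv u v n := by
  rw [Nat.sum_antidiagonal_eq_sum_range_succ (fun i j => u i * v j), Nat.succ_eq_add_one]
  have hrev : ∀ m k, m + k = n + 1 →
      ∑ i ∈ range k, u (m + i) * v (n - (m + i)) = ∑ i ∈ range k, v i * u (n - i) := by
    intro m k hk
    rw [← sum_range_reflect]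
    refine sum_congr rfl fun i hi => ?_
    have := mem_range.1 hi
    rw [show m + (k - 1 - i) = n - i by omega, show n - (n - i) = i by omega, mul_comm]
  rcases Nat.even_or_odd' n with ⟨m, rfl | rfl⟩
  · rw [show 2 * m + 1 = m + 1 + m by omega, sum_range_add, hrev _ _ (by omega), sum_range_succ,
      halfConv, halfConv, diagConv, if_pos (by simp), show (2 * m + 1) / 2 = m by omega,
      show 2 * m / 2 = m by omega, show 2 * m - m = m by omega]
    ring
  · rw [show 2 * m + 1 + 1 = (m + 1) + (m + 1) by omega, sum_range_add, hrev _ _ (by omega),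
      halfConv, halfConv, diagConv, if_neg (by simp), show (2 * m + 1 + 1) / 2 = m + 1 by omega]
    ring

namespace SlowWeight

variable {h : ℕ → ℝ}

theorem nonneg (H : SlowWeight h) (n : ℕ) : 0 ≤ h n := by
  rcases n with _ | n
  · exact H.zero.ge
  · exact (H.pos _ (by omega)).le

/-- Source of the contraction factor 1/2: the two halves of `h * h` coincide and the diagonal is
nonnegative. -/
theorem halfConv_self_le (H : SlowWeight h) {n : ℕ} (hn : 2 ≤ n) : halfConv h h n ≤ h n / 2 := by
  have h₁ := H.conv_le n hn
  rw [sum_antidiagonal_eq_halfConv] at h₁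
  have h₂ : 0 ≤ diagConv h h n := by
    rw [diagConv]
    split_ifs
    · exact mul_nonneg (H.nonneg _) (H.nonneg _)
    · exact le_rfl
  linarith

theorem tendsto_ratio_sub (H : SlowWeight h) (i : ℕ) :
    Tendsto (fun n => h (n - i) / h n) atTop (𝓝 1) := by
  rw [← tendsto_add_atTop_iff_nat i]
  simp only [Nat.add_sub_cancel]
  induction i with
  | zero =>
    refine tendsto_const_nhds.congr' ?_
    filter_upwards [eventually_ge_atTop 1] with n hn
    rw [add_zero, div_self (H.pos n hn).ne']
  | succ i ih =>
    have h₁ := (H.ratio.comp (tendsto_add_atTop_nat i)).inv₀ one_ne_zero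
    have h₂ := ih.mul h₁
    simp only [inv_one, mul_one] at h₂
    refine h₂.congr' ?_
    filter_upwards [eventually_ge_atTop 1] with n hn
    have := (H.pos (n + i) (by omega)).ne'
    have := (H.pos (n + (i + 1)) (by omega)).ne'
    simp only [Function.comp, ← add_assoc] at *
    field_simp

/-- Dominated convergence: `v (n - i) / h n → ν` for fixed `i`, and `doubling` bounds this quotient
as long as `2 * i ≤ n`. -/
theorem tendsto_halfConv (H : SlowWeight h) {u v : ℕ → ℝ} {C D ν : ℝ} (hu : ∀ n, |u n| ≤ C * h n)
    (hv : ∀ n, |v n| ≤ D * h n) (hν : Tendsto (fun n => v n / h n) atTop (𝓝 ν)) :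
    Tendsto (fun n => halfConv u v n / h n) atTop (𝓝 ((∑' i, u i) * ν)) := by
  obtain ⟨K, hK⟩ := H.doubling
  have hD : 0 ≤ D := by
    have h₁ := (abs_nonneg _).trans (hv 1)
    exact nonneg_of_mul_nonneg_left h₁ (H.pos 1 le_rfl)
  have hK0 : 0 ≤ K := by
    have h₁ := (H.nonneg _).trans (hK 0 1 (by omega))
    exact nonneg_of_mul_nonneg_left h₁ (H.pos 1 le_rfl)
  rw [← tsum_mul_right]
  have key := tendsto_tsum_of_dominated_convergence (𝓕 := atTop)
    (f := fun n i => if i < (n + 1) / 2 then u i * (v (n - i) / h n) else 0)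
    (g := fun i => u i * ν) (bound := fun i => C * h i * (D * K))
    ((H.summable.mul_left C).mul_right _) ?_ ?_
  · refine key.congr fun n => ?_
    rw [tsum_eq_sum (s := range ((n + 1) / 2)), halfConv, sum_div]
    · refine sum_congr rfl fun i hi => ?_
      rw [if_pos (mem_range.1 hi), mul_div_assoc]
    · intro i hi
      rw [if_neg (fun h' => hi (mem_range.2 h'))]
  · intro i
    have h₁ : Tendsto (fun n => u i * (v (n - i) / h (n - i) * (h (n - i) / h n))) atTop
        (𝓝 (u i * (ν * 1))) :=
      ((hν.comp (tendsto_sub_atTop_nat i)).mul (H.tendsto_ratio_sub i)).const_mul _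
    rw [mul_one] at h₁
    refine h₁.congr' ?_
    filter_upwards [eventually_ge_atTop (2 * i + 1)] with n hn
    rw [if_pos (by omega), div_mul_div_cancel₀ (H.pos (n - i) (by omega)).ne']
  · filter_upwards [eventually_ge_atTop 1] with n hn i
    have hC : 0 ≤ C * h i := (abs_nonneg _).trans (hu i)
    split_ifs with hi
    · rw [Real.norm_eq_abs, abs_mul, abs_div, abs_of_pos (H.pos n hn)]
      refine mul_le_mul (hu i) ?_ (by have := H.pos n hn; positivity) hC
      rw [div_le_iff₀ (H.pos n hn)]
      calc |v (n - i)| ≤ D * h (n - i) := hv _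
        _ ≤ D * (K * h n) := mul_le_mul_of_nonneg_left (hK i n (by omega)) hD
        _ = D * K * h n := by ring
    · rw [norm_zero]
      positivity

theorem tendsto_diagConv (H : SlowWeight h) {u v : ℕ → ℝ} (hu : ∀ n, |u n| ≤ h n)
    (hv : ∀ n, |v n| ≤ h n) : Tendsto (fun n => diagConv u v n / h n) atTop (𝓝 0) := by
  obtain ⟨K, hK⟩ := H.doubling
  have h₁ : Tendsto (fun n : ℕ => h (n / 2) * K) atTop (𝓝 0) := by
    have h₂ := (H.summable.tendsto_atTop_zero.comp
      (Nat.tendsto_div_const_atTop (two_ne_zero))).mul_const K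
    simpa using h₂
  refine squeeze_zero_norm' ?_ h₁
  filter_upwards [eventually_ge_atTop 1] with n hn
  have hd := H.pos n hn
  rw [Real.norm_eq_abs, abs_div, abs_of_pos hd, div_le_iff₀ hd, diagConv]
  have hKn : h (n / 2) * (h (n - n / 2)) ≤ h (n / 2) * (K * h n) :=
    mul_le_mul_of_nonneg_left (hK _ _ (by omega)) (H.nonneg _)
  split_ifs with he
  · rw [abs_mul]
    rw [show n - n / 2 = n / 2 by obtain ⟨m, rfl⟩ := he; omega] at hKn
    have := mul_le_mul (hu (n / 2)) (hv (n / 2)) (abs_nonneg _) (H.nonneg _)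
    linarith
  · rw [abs_zero, mul_assoc]
    exact (mul_nonneg (H.nonneg _) (H.nonneg _)).trans hKn

end SlowWeight

/-- A bounded sequence which contracts, up to a null sequence, relative to its later half
is a null sequence. -/
theorem tendsto_zero_of_contraction {φ δ : ℕ → ℝ} {B : ℝ} (h0 : ∀ n, 0 ≤ φ n) (hB : ∀ n, φ n ≤ B)
    (hδ : Tendsto δ atTop (𝓝 0))
    (hφ : ∀ n s, 2 ≤ n → (∀ m, n ≤ 2 * m → φ m ≤ s) → φ n ≤ δ n + s / 2) :
    Tendsto φ atTop (𝓝 0) := by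
  have step : ∀ k : ℕ, ∀ᶠ n in atTop, φ n ≤ (|B| + 1) * (3 / 4) ^ k := by
    intro k
    induction k with
    | zero =>
      refine Eventually.of_forall fun n => ?_
      rw [pow_zero, mul_one]
      linarith [hB n, le_abs_self B]
    | succ k ih =>
      obtain ⟨N, hN⟩ := eventually_atTop.1 ih
      have hs : 0 < (|B| + 1) * (3 / 4 : ℝ) ^ k := by positivity
      -- Once `δ n < s / 4`, the bound `s` improves to `s / 2 + s / 4`.
      filter_upwards [eventually_ge_atTop (2 * N + 2),
        hδ.eventually (gt_mem_nhds (show 0 < (|B| + 1) * (3 / 4 : ℝ) ^ k / 4 by positivity))]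
        with n hn hd
      have := hφ n _ (by omega) fun m hm => hN m (by omega)
      rw [pow_succ]
      linarith
  have hlim : Tendsto (fun k : ℕ => (|B| + 1) * (3 / 4 : ℝ) ^ k) atTop (𝓝 0) := by
    simpa using (tendsto_pow_atTop_nhds_zero_of_lt_one (by norm_num : (0 : ℝ) ≤ 3 / 4)
      (by norm_num)).const_mul (|B| + 1)
  rw [tendsto_order]
  refine ⟨fun x hx => Eventually.of_forall fun n => hx.trans_le (h0 n), fun x hx => ?_⟩
  obtain ⟨k, hk⟩ := (hlim.eventually (gt_mem_nhds hx)).exists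
  filter_upwards [step k] with n hn using hn.trans_lt hk

namespace SlowWeight

variable {h : ℕ → ℝ}

/-- A solution of `u = (w - u) * u` (convolution) is asymptotically proportional to the weight
whenever `w` is. -/
theorem tendsto_of_conv (H : SlowWeight h) {u w : ℕ → ℝ} {ω L : ℝ} (hu0 : ∀ n, 0 ≤ u n)
    (huw : ∀ n, u n ≤ w n) (hwh : ∀ n, w n ≤ h n)
    (hrec : ∀ n, 2 ≤ n → u n = ∑ p ∈ antidiagonal n, (w p.1 - u p.1) * u p.2)
    (hω : Tendsto (fun n => w n / h n) atTop (𝓝 ω))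
    (hL : ((∑' i, w i) - 2 * ∑' i, u i) * L + (∑' i, u i) * ω = L) :
    Tendsto (fun n => u n / h n) atTop (𝓝 L) := by
  have hw0 : ∀ n, 0 ≤ w n := fun n => (hu0 n).trans (huw n)
  have hsu : Summable u := H.summable.of_nonneg_of_le hu0 fun n => (huw n).trans (hwh n)
  have hsw : Summable w := H.summable.of_nonneg_of_le hw0 hwh
  have hau : ∀ n, |u n| ≤ h n := fun n => by
    rw [abs_of_nonneg (hu0 n)]; exact (huw n).trans (hwh n)
  have haw : ∀ n, |w n| ≤ h n := fun n => by rw [abs_of_nonneg (hw0 n)]; exact hwh n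
  have hac : ∀ n, |w n - 2 * u n| ≤ h n := fun n =>
    abs_le.2 ⟨by linarith [hu0 n, huw n, hwh n], by linarith [hu0 n, huw n, hwh n]⟩
  have had : ∀ n, |w n - u n| ≤ h n := fun n =>
    abs_le.2 ⟨by linarith [hu0 n, huw n, hwh n], by linarith [hu0 n, huw n, hwh n]⟩
  have hone : Tendsto (fun n => h n / h n) atTop (𝓝 1) := by
    refine tendsto_const_nhds.congr' ?_
    filter_upwards [eventually_ge_atTop 1] with n hn
    rw [div_self (H.pos n hn).ne']
  have t₁ := H.tendsto_halfConv (u := fun n => w n - 2 * u n) (C := 1) (D := 1)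
    (by simpa using hac) (by simpa using fun n => abs_of_nonneg (H.nonneg n) |>.le) hone
  have t₂ := H.tendsto_halfConv (C := 1) (D := 1) (by simpa using hau) (by simpa using haw) hω
  have t₃ := H.tendsto_diagConv (u := fun n => w n - u n) had hau
  have hsum : ∑' i, (w i - 2 * u i) = (∑' i, w i) - 2 * ∑' i, u i := by
    rw [hsw.tsum_sub (hsu.mul_left 2), tsum_mul_left]
  rw [hsum, mul_one] at t₁
  set δ : ℕ → ℝ := fun n => |(halfConv (fun n => w n - 2 * u n) h n / h n * L +
    halfConv u w n / h n + diagConv (fun n => w n - u n) u n / h n) - L| with hδdef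
  have tδ : Tendsto δ atTop (𝓝 0) := by
    have := (((t₁.mul_const L).add t₂).add t₃).sub_const L |>.abs
    rwa [add_zero, hL, sub_self, abs_zero] at this
  -- The halves of `(w - u) * u` regroup as those of `(w - 2u, u)` and `(u, w)`; then the late
  -- factor `u` is split as `L * h` plus an error.
  have hdecomp : ∀ n, 2 ≤ n → u n = halfConv (fun n => w n - 2 * u n) h n * L +
      halfConv u w n + diagConv (fun n => w n - u n) u n +
      halfConv (fun n => w n - 2 * u n) (fun n => u n - L * h n) n := by
    intro n hn
    rw [hrec n hn, sum_antidiagonal_eq_halfConv (fun n => w n - u n) u n]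
    simp only [halfConv, sum_mul, add_right_comm _ (diagConv _ _ _), ← sum_add_distrib]
    congr 1
    exact sum_congr rfl fun i _ => by ring
  have main : Tendsto (fun n => |u n / h n - L|) atTop (𝓝 0) := by
    refine tendsto_zero_of_contraction (B := 1 + |L|) (fun n => abs_nonneg _) (fun n => ?_) tδ ?_
    · refine (abs_sub _ _).trans (add_le_add ?_ le_rfl)
      rw [abs_div, abs_of_nonneg (H.nonneg n)]
      exact div_le_one_of_le₀ (hau n) (H.nonneg n)
    · intro n s hn hs
      have hp := H.pos n (by omega)
      have hs0 : 0 ≤ s := (abs_nonneg _).trans (hs n (by omega))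
      -- Only indices `n - i > n / 2` of the error occur, where the bound `s` applies.
      have herr : |halfConv (fun n => w n - 2 * u n) (fun n => u n - L * h n) n| ≤
          s * (h n / 2) := by
        refine le_trans ?_ (mul_le_mul_of_nonneg_left (H.halfConv_self_le hn) hs0)
        rw [halfConv, halfConv, mul_sum]
        refine (abs_sum_le_sum_abs _ _).trans (sum_le_sum fun i hi => ?_)
        have hi := mem_range.1 hi
        have hq := H.pos (n - i) (by omega)
        have h₁ : |u (n - i) - L * h (n - i)| ≤ s * h (n - i) := by
          have h₂ := hs (n - i) (by omega)
          rw [div_sub' hq.ne', abs_div, abs_of_pos hq, div_le_iff₀ hq] at h₂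
          rwa [mul_comm L]
        rw [abs_mul]
        calc _ ≤ h i * (s * h (n - i)) := mul_le_mul (hac i) h₁ (abs_nonneg _) (H.nonneg i)
          _ = _ := by ring
      have hsplit : u n / h n - L = (halfConv (fun n => w n - 2 * u n) h n / h n * L +
          halfConv u w n / h n + diagConv (fun n => w n - u n) u n / h n - L) +
          halfConv (fun n => w n - 2 * u n) (fun n => u n - L * h n) n / h n := by
        conv_lhs => rw [hdecomp n hn]
        ring
      rw [hsplit]
      refine (abs_add_le _ _).trans (add_le_add le_rfl ?_)
      rw [abs_div, abs_of_pos hp, div_le_iff₀ hp]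
      linarith
  exact tendsto_sub_nhds_zero_iff.1 ((tendsto_zero_iff_abs_tendsto_zero _).2 main)

end SlowWeight

/-- The sum of a solution of a convolution equation `u = v * u` valid from index `2` on. -/
theorem tsum_eq_of_conv {u v : ℕ → ℝ} (hu : Summable u) (hv : Summable v) (hu0 : ∀ n, 0 ≤ u n)
    (hv0 : ∀ n, 0 ≤ v n) (zu : u 0 = 0) (zv : v 0 = 0)
    (hrec : ∀ n, 2 ≤ n → u n = ∑ p ∈ antidiagonal n, v p.1 * u p.2) :
    ∑' n, u n = u 1 + (∑' n, v n) * ∑' n, u n := by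
  have hnu : Summable fun n => ‖u n‖ := by simpa [abs_of_nonneg (hu0 _)] using hu
  have hnv : Summable fun n => ‖v n‖ := by simpa [abs_of_nonneg (hv0 _)] using hv
  have hc := (summable_norm_sum_mul_antidiagonal_of_summable_norm hnv hnu).of_norm
  rw [tsum_mul_tsum_eq_tsum_sum_antidiagonal_of_summable_norm hnv hnu,
    ← tsum_ite_eq 1 (fun _ => u 1), ← (hasSum_ite_eq 1 (u 1)).summable.tsum_add hc]
  refine tsum_congr fun n => ?_
  -- The convolution vanishes at 0 and 1, so `u 1` is the only correction.
  match n with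
  | 0 => simp [zu]
  | 1 => simp [Nat.sum_antidiagonal_succ, zu, zv]
  | n + 2 => simp [hrec (n + 2) (by omega)]

/-! ### The scaled Catalan weight -/

/-- The total number of outputs, scaled by `16 ^ n`. -/
noncomputable def scaledTotal (n : ℕ) : ℝ := g n / 16 ^ n

theorem scaledTotal_succ (n : ℕ) :
    scaledTotal (n + 1) = n.centralBinom / (4 ^ (n + 1) * (n + 1)) := by
  rw [scaledTotal, g_succ, ← succ_mul_catalan_eq_centralBinom, show (16 : ℝ) = 4 * 4 by norm_num,
    mul_pow]
  push_cast
  field_simp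

theorem scaledTotal_pos (n : ℕ) (hn : 1 ≤ n) : 0 < scaledTotal n := by
  obtain ⟨m, rfl⟩ := Nat.exists_eq_add_of_le' hn
  rw [scaledTotal_succ]
  have := Nat.cast_pos (α := ℝ).2 m.centralBinom_pos
  positivity

theorem scaledTotal_add_two (n : ℕ) :
    scaledTotal (n + 2) * (2 * (n + 2)) = scaledTotal (n + 1) * (2 * n + 1) := by
  rw [scaledTotal_succ, scaledTotal_succ]
  have h : ((n : ℝ) + 1) * (n + 1).centralBinom = 2 * (2 * n + 1) * n.centralBinom := by
    exact_mod_cast n.succ_mul_centralBinom_succ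
  push_cast
  have h' : ((n + 1).centralBinom : ℝ) = 2 * (2 * n + 1) * n.centralBinom / (n + 1) := by
    field_simp
    linarith
  rw [h']
  field_simp
  ring

-- Squaring removes the half-integer power and exposes the Wallis product, whose limit π / 2 makes
-- the right side tend to 1.
open Real in
theorem sq_scaledTotal_succ (n : ℕ) :
    (scaledTotal (n + 1) * (4 * √π * ((n + 1 : ℕ) : ℝ) ^ (3 / 2 : ℝ))) ^ 2 =
      π * ((n + 1) / (2 * n + 1)) / Wallis.W n := by
  have h₁ : (((n + 1 : ℕ) : ℝ) ^ (3 / 2 : ℝ)) ^ 2 = ((n : ℝ) + 1) ^ 3 := by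
    rw [← rpow_natCast, ← rpow_mul (by positivity), ← rpow_natCast]
    norm_num
  have h₂ : (n.centralBinom : ℝ) = (2 * n).factorial / (n.factorial) ^ 2 := by
    rw [Nat.centralBinom_eq_two_mul_choose, Nat.cast_choose ℝ (by omega),
      show 2 * n - n = n by omega, sq]
  rw [mul_pow, mul_pow, mul_pow, h₁, sq_sqrt pi_pos.le, Wallis.W_eq_factorial_ratio,
    scaledTotal_succ, h₂, show (2 : ℝ) ^ (4 * n) = (4 ^ n) ^ 2 by
      rw [show (4 : ℝ) = 2 ^ 2 by norm_num, ← pow_mul, ← pow_mul]; ring_nf]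
  have := Nat.cast_pos (α := ℝ).2 n.factorial_pos
  have := Nat.cast_pos (α := ℝ).2 (2 * n).factorial_pos
  field_simp
  ring

open Real in
theorem tendsto_scaledTotal_mul :
    Tendsto (fun n : ℕ => scaledTotal n * (4 * √π * (n : ℝ) ^ (3 / 2 : ℝ))) atTop (𝓝 1) := by
  rw [← tendsto_add_atTop_iff_nat 1]
  have h₁ : Tendsto (fun n : ℕ => ((n : ℝ) + 1) / (2 * n + 1)) atTop (𝓝 (1 / 2)) := by
    simpa [add_comm] using tendsto_add_mul_div_add_mul_atTop_nhds (𝕜 := ℝ) 1 1 1 two_ne_zero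
  have h₂ := ((h₁.const_mul π).div Wallis.tendsto_W_nhds_pi_div_two (by positivity)).sqrt
  rw [show π * (1 / 2) / (π / 2) = 1 by field_simp, sqrt_one] at h₂
  refine h₂.congr fun n => ?_
  have := scaledTotal_pos (n + 1) (by omega)
  simp only [Pi.div_apply]
  rw [← sq_scaledTotal_succ, sqrt_sq (by positivity)]

theorem scaledTotal_isEquivalent : scaledTotal ~[atTop]
    fun n : ℕ => (4 * √Real.pi * (n : ℝ) ^ (3 / 2 : ℝ))⁻¹ := by
  refine (isEquivalent_iff_tendsto_one ?_).2 ?_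
  · filter_upwards [eventually_ge_atTop 1] with n hn
    have : (0 : ℝ) < n := by exact_mod_cast hn
    have := Real.pi_pos
    positivity
  · refine tendsto_scaledTotal_mul.congr fun n => ?_
    rw [Pi.div_apply, div_inv_eq_mul]

theorem summable_scaledTotal : Summable scaledTotal := by
  refine summable_of_isBigO_nat ((Real.summable_nat_rpow_inv (p := 3 / 2)).2 (by norm_num))
    (scaledTotal_isEquivalent.isBigO.trans ?_)
  simp only [mul_inv (4 * √Real.pi)]
  exact (isBigO_refl _ _).const_mul_left _

/-- The sequence `n ^ 2 * scaledTotal n` is nondecreasing, and `n ≤ 2 * (n - i)` costs the factor 4.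
-/
theorem scaledTotal_le_four_mul (i n : ℕ) (h : 2 * i ≤ n) :
    scaledTotal (n - i) ≤ 4 * scaledTotal n := by
  have hmono : Monotone fun m : ℕ => ((m : ℝ) + 1) ^ 2 * scaledTotal (m + 1) := by
    refine monotone_nat_of_le_succ fun m => ?_
    have h₁ := scaledTotal_pos (m + 1) (by omega)
    have h₂ : scaledTotal (m + 2) = scaledTotal (m + 1) * (2 * m + 1) / (2 * (m + 2)) := by
      rw [eq_div_iff (by positivity), scaledTotal_add_two]
    rw [h₂]
    push_cast
    rw [mul_div_assoc', le_div_iff₀ (by positivity)]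
    have : 0 ≤ scaledTotal (m + 1) * ((m : ℝ) * (m + 2)) := by positivity
    nlinarith
  rcases Nat.eq_zero_or_pos n with rfl | hn
  · simp [scaledTotal, g_zero]
  · obtain ⟨m, rfl⟩ : ∃ m, n = m + 1 := ⟨n - 1, by omega⟩
    have h₁ := hmono (show m - i ≤ m by omega)
    simp only at h₁
    rw [show m + 1 - i = m - i + 1 by omega]
    have h₂ : (m : ℝ) + 1 ≤ 2 * ((m - i : ℕ) + 1) := by
      have : m + 1 ≤ 2 * (m - i + 1) := by omega
      exact_mod_cast this
    have h₃ := scaledTotal_pos (m + 1) (by omega)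
    have h₄ : ((m : ℝ) + 1) ^ 2 ≤ 4 * ((m - i : ℕ) + 1 : ℝ) ^ 2 := by
      calc ((m : ℝ) + 1) ^ 2 ≤ (2 * ((m - i : ℕ) + 1 : ℝ)) ^ 2 := by gcongr
        _ = _ := by ring
    have h₅ := mul_le_mul_of_nonneg_right h₄ h₃.le
    have h₆ : (0 : ℝ) < ((m - i : ℕ) + 1 : ℝ) ^ 2 := by positivity
    refine le_of_mul_le_mul_left ?_ h₆
    linarith

/-- Scaling by `16 ^ n` is compatible with convolutions. -/
theorem scaled_eq_sum {x y z : ℕ → ℕ} {n : ℕ} (h : z n = ∑ p ∈ antidiagonal n, x p.1 * y p.2) :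
    (z n : ℝ) / 16 ^ n =
      ∑ p ∈ antidiagonal n, ((x p.1 : ℝ) / 16 ^ p.1) * ((y p.2 : ℝ) / 16 ^ p.2) := by
  rw [h, Nat.cast_sum, sum_div]
  refine sum_congr rfl fun p hp => ?_
  rw [← HasAntidiagonal.mem_antidiagonal.1 hp, pow_add, div_mul_div_comm, Nat.cast_mul]

theorem slowWeight_scaledTotal : SlowWeight scaledTotal where
  zero := by simp [scaledTotal, g_zero]
  pos := scaledTotal_pos
  summable := summable_scaledTotal
  ratio := by
    rw [← tendsto_add_atTop_iff_nat 1]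
    have h₁ : Tendsto (fun n : ℕ => ((1 : ℝ) + 2 * n) / (4 + 2 * n)) atTop (𝓝 (2 / 2)) :=
      tendsto_add_mul_div_add_mul_atTop_nhds (𝕜 := ℝ) 1 4 2 two_ne_zero
    rw [div_self two_ne_zero] at h₁
    refine h₁.congr fun n => ?_
    have h₂ := scaledTotal_pos (n + 1) (by omega)
    rw [div_eq_div_iff (by positivity) h₂.ne']
    linarith [scaledTotal_add_two n]
  doubling := ⟨4, scaledTotal_le_four_mul⟩
  conv_le n hn := (scaled_eq_sum (g_eq_sum hn)).ge

/-- The sum satisfies `S = 1 / 4 + S ^ 2`, which has the double root 1/2. -/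
theorem tsum_scaledTotal : ∑' n, scaledTotal n = 1 / 2 := by
  have H := slowWeight_scaledTotal
  have h := tsum_eq_of_conv H.summable H.summable H.nonneg H.nonneg H.zero H.zero
    fun n hn => scaled_eq_sum (g_eq_sum hn)
  have h₁ : scaledTotal 1 = 1 / 4 := by rw [scaledTotal, g_one]; norm_num
  rw [h₁] at h
  have : (∑' n, scaledTotal n - 1 / 2) ^ 2 = 0 := by linarith
  linarith [pow_eq_zero_iff (two_ne_zero) |>.1 this]

/-! ### Peeling off one truth value -/

/-- Suppose the counts `x` satisfy the convolution equation `x = y * x` from index `2` on, and the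
sum and the limiting proportion of `x + y` are known. Then so are those of `y`, as well as the
limiting proportion of `x`; here `r` is the sum of `x`, scaled by `16 ^ n`. -/
theorem tendsto_scaled_of_conv {x y : ℕ → ℕ} {W ω r : ℝ} (hxy : ∀ n, x n + y n ≤ g n)
    (x1 : x 1 = 1) (hrec : ∀ n, 2 ≤ n → x n = ∑ p ∈ antidiagonal n, y p.1 * x p.2)
    (hW : ∑' n, ((x n : ℝ) + y n) / 16 ^ n = W)
    (hω : Tendsto (fun n => ((x n : ℝ) + y n) / 16 ^ n / scaledTotal n) atTop (𝓝 ω))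
    (hr0 : 0 < r) (hW1 : W < 1) (hr : r ^ 2 + (1 - W) * r = 1 / 16) :
    ∑' n, (y n : ℝ) / 16 ^ n = W - r ∧
      Tendsto (fun n => (x n : ℝ) / 16 ^ n / scaledTotal n) atTop (𝓝 (r * ω / (1 - W + 2 * r))) ∧
      Tendsto (fun n => (y n : ℝ) / 16 ^ n / scaledTotal n) atTop
        (𝓝 (ω - r * ω / (1 - W + 2 * r))) := by
  have H := slowWeight_scaledTotal
  have hle : ∀ n, ((x n : ℝ) + y n) / 16 ^ n ≤ scaledTotal n := fun n => by
    rw [scaledTotal]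
    gcongr
    exact_mod_cast hxy n
  have hxw : ∀ n, (x n : ℝ) / 16 ^ n ≤ ((x n : ℝ) + y n) / 16 ^ n := fun n => by
    gcongr
    simp
  have hyw : ∀ n, (y n : ℝ) / 16 ^ n ≤ ((x n : ℝ) + y n) / 16 ^ n := fun n => by
    gcongr
    simp
  have sx : Summable fun n => (x n : ℝ) / 16 ^ n :=
    H.summable.of_nonneg_of_le (fun n => by positivity) fun n => (hxw n).trans (hle n)
  have sy : Summable fun n => (y n : ℝ) / 16 ^ n :=
    H.summable.of_nonneg_of_le (fun n => by positivity) fun n => (hyw n).trans (hle n)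
  have z := hxy 0
  rw [g_zero] at z
  have hX := tsum_eq_of_conv sx sy (fun n => by positivity) (fun n => by positivity)
    (by simp [show x 0 = 0 by omega]) (by simp [show y 0 = 0 by omega])
    fun n hn => scaled_eq_sum (hrec n hn)
  have hXY : (∑' n, (x n : ℝ) / 16 ^ n) + ∑' n, (y n : ℝ) / 16 ^ n = W := by
    rw [← sx.tsum_add sy, ← hW]
    exact tsum_congr fun n => by ring
  have hX0 : 0 ≤ ∑' n, (x n : ℝ) / 16 ^ n := tsum_nonneg fun n => by positivity
  have hXr : ∑' n, (x n : ℝ) / 16 ^ n = r := by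
    set X := ∑' n, (x n : ℝ) / 16 ^ n
    rw [show ∑' n, (y n : ℝ) / 16 ^ n = W - X by linarith, x1, Nat.cast_one, pow_one] at hX
    -- `X` and `r` solve the same quadratic; its other root is negative.
    have h₁ : (X - r) * (X + r + (1 - W)) = 0 := by linarith
    have h₂ : X + r + (1 - W) ≠ 0 := (by linarith : 0 < X + r + (1 - W)).ne'
    linarith [(mul_eq_zero.1 h₁).resolve_right h₂]
  have hd : 1 - W + 2 * r ≠ 0 := by
    have : 0 < 1 - W + 2 * r := by linarith
    exact this.ne'
  have hlim := H.tendsto_of_conv (u := fun n => (x n : ℝ) / 16 ^ n)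
    (w := fun n => ((x n : ℝ) + y n) / 16 ^ n) (ω := ω) (L := r * ω / (1 - W + 2 * r))
    (fun n => by positivity) hxw hle (fun n hn => by
      rw [scaled_eq_sum (hrec n hn)]
      exact sum_congr rfl fun p _ => by ring) hω (by
      rw [hW, hXr]
      field_simp
      ring)
  refine ⟨by linarith, hlim, (hω.sub hlim).congr fun n => ?_⟩
  ring

/-! ### Algebra of the constants -/

theorem sq_sqrt_two : √2 ^ 2 = (2 : ℝ) := Real.sq_sqrt (by norm_num)

theorem sqrt_two_gt_one : 1 < √(2 : ℝ) := by
  rw [Real.lt_sqrt (by norm_num)]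
  norm_num

theorem sqrt_two_lt_two : √(2 : ℝ) < 2 := by
  rw [Real.sqrt_lt' (by norm_num)]
  norm_num

theorem β_sq : β ^ 2 = 7 + 2 * √2 := Real.sq_sqrt (by positivity)

theorem β_gt : 1 + √2 < β := by
  rw [β, Real.lt_sqrt (by positivity)]
  nlinarith [sq_sqrt_two]

theorem β_pos : 0 < β := by linarith [β_gt, sqrt_two_gt_one]

theorem α_pos : 0 < α := by rw [α]; linarith [β_pos, sqrt_two_gt_one]

theorem γ_sq : γ ^ 2 = 16 + α ^ 2 := Real.sq_sqrt (by positivity)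

theorem γ_gt : α < γ := by
  rw [γ, Real.lt_sqrt α_pos.le]
  linarith

theorem γ_pos : 0 < γ := α_pos.trans γ_gt

/-- Since `β ^ 2 - (1 + √2) ^ 2 = 4`; with `γ_mul` this turns the roots `r`, which are differences,
into the reciprocals in `pA` and `pB`. -/
theorem α_mul : α * (β - 1 - √2) = 4 := by
  rw [α]
  nlinarith [β_sq, sq_sqrt_two]

theorem α_sq : α ^ 2 = 2 * α * β - 4 := by
  have h : α * (2 * β - α) = 4 := by
    rw [← α_mul, α]
    ring
  linarith

theorem γ_mul : (α + γ) * (γ - α) = 16 := by linarith [γ_sq]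

/-- This and its analogues for `pA`, `pB` evaluate `r * ω / (1 - W + 2 * r)`; the denominators are
`√2 / 2`, `β / 4`, `γ / 8`. -/
theorem pBot_eq : (√2 - 1) / 4 * 1 / (1 - 1 / 2 + 2 * ((√2 - 1) / 4)) = pBot := by
  have := sqrt_two_gt_one
  rw [pBot, show 1 - 1 / 2 + 2 * ((√2 - 1) / 4) = √2 / 2 by ring]
  field_simp
  linarith [sq_sqrt_two]

theorem pA_eq : (β - 1 - √2) / 8 * (1 - pBot) /
    (1 - (1 / 2 - (√2 - 1) / 4) + 2 * ((β - 1 - √2) / 8)) = pA := by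
  have := β_pos
  have := α_pos
  rw [pA, pBot, show 1 - (1 / 2 - (√2 - 1) / 4) + 2 * ((β - 1 - √2) / 8) = β / 4 by ring,
    show β - 1 - √2 = 4 / α by rw [eq_div_iff α_pos.ne', ← α_mul]; ring]
  field_simp
  ring

theorem one_sub_pBot_sub_pA : 1 - pBot - pA = (2 + √2) * α / (8 * β) := by
  have := β_pos
  have := α_pos
  rw [pA, pBot]
  field_simp
  linear_combination (-8 * (2 + √2)) * α_sq

theorem pB_eq : (γ - α) / 16 * (1 - pBot - pA) /
    (1 - (1 / 2 - (√2 - 1) / 4 - (β - 1 - √2) / 8) + 2 * ((γ - α) / 16)) = pB := by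
  have := β_pos
  have := α_pos
  have := γ_pos
  rw [one_sub_pBot_sub_pA, pB,
    show 1 - (1 / 2 - (√2 - 1) / 4 - (β - 1 - √2) / 8) + 2 * ((γ - α) / 16) = γ / 8 by
      rw [α]; ring,
    show γ - α = 16 / (α + γ) by rw [eq_div_iff (by positivity), ← γ_mul]; ring]
  field_simp

theorem pTop_eq : 1 - pBot - pA - pB = pTop := by
  have := β_pos
  have := α_pos
  have := γ_pos
  rw [one_sub_pBot_sub_pA, pB, pTop]
  field_simp
  linear_combination 8 * γ_sq

/-- A nonzero limit is what turns a proportion into an asymptotic equivalence. -/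
theorem pBot_pos : 0 < pBot := by rw [pBot]; linarith [sqrt_two_lt_two]

theorem pA_pos : 0 < pA := by
  have := β_pos
  have := α_pos
  rw [pA]
  positivity

theorem pB_pos : 0 < pB := by
  have := β_pos
  have := α_pos
  have := γ_pos
  rw [pB]
  positivity

theorem pTop_pos : 0 < pTop := by
  have := β_pos
  have := α_pos
  have := γ_pos
  rw [pTop]
  positivity

/-! ### Limiting proportions and asymptotics -/

theorem tendsto_proportions :
    Tendsto (fun n => (f n : ℝ) / g n) atTop (𝓝 pBot) ∧
      Tendsto (fun n => (a n : ℝ) / g n) atTop (𝓝 pA) ∧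
      Tendsto (fun n => (b n : ℝ) / g n) atTop (𝓝 pB) ∧
      Tendsto (fun n => (t n : ℝ) / g n) atTop (𝓝 pTop) := by
  have hdiv : ∀ (x : ℕ → ℕ) (n : ℕ), (x n : ℝ) / 16 ^ n / scaledTotal n = x n / g n :=
    fun x n => div_div_div_cancel_right₀ (by positivity) _ _
  have hg : ∀ n, (f n : ℝ) + (a n + b n + t n : ℕ) = g n := fun n => by
    rw [g]
    push_cast
    ring
  have hone : Tendsto (fun n => ((f n : ℝ) + (a n + b n + t n : ℕ)) / 16 ^ n / scaledTotal n) atTop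
      (𝓝 1) := by
    refine tendsto_const_nhds.congr' ?_
    filter_upwards [eventually_ge_atTop 1] with n hn
    rw [hg, ← scaledTotal, div_self (scaledTotal_pos n hn).ne']
  have s2 := sqrt_two_gt_one
  have s2' := sqrt_two_lt_two
  have hβ := β_gt
  have hγ := γ_gt
  have hα := α_pos
  -- In the three applications `1 - W` equals `1 / 2`, `(1 + √2) / 4`, `α / 8`, and `r` is the
  -- positive root.
  obtain ⟨W₁, l₁, r₁⟩ := tendsto_scaled_of_conv (x := f) (y := fun n => a n + b n + t n)
    (W := 1 / 2) (ω := 1) (r := (√2 - 1) / 4) (fun n => by rw [g]; omega) (count_one _)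
    (fun n hn => f_eq_sum hn)
    (by simp only [hg]; exact tsum_scaledTotal) hone (by linarith) (by norm_num)
    (by linear_combination sq_sqrt_two / 16)
  rw [pBot_eq] at l₁ r₁
  have e₁ : ∀ n, ((a n + b n + t n : ℕ) : ℝ) = a n + (b n + t n : ℕ) := fun n => by
    push_cast
    ring
  simp only [e₁] at W₁ r₁
  obtain ⟨W₂, l₂, r₂⟩ := tendsto_scaled_of_conv (x := a) (y := fun n => b n + t n)
    (r := (β - 1 - √2) / 8) (fun n => by rw [g]; omega) (count_one _)
    (fun n hn => a_eq_sum hn) W₁ r₁ (by linarith) (by linarith)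
    (by linear_combination β_sq / 64 - sq_sqrt_two / 64)
  rw [pA_eq] at l₂ r₂
  simp only [Nat.cast_add] at W₂ r₂
  obtain ⟨-, l₃, r₃⟩ := tendsto_scaled_of_conv (x := b) (y := t)
    (r := (γ - α) / 16) (fun n => by rw [g]; omega) (count_one _)
    (fun n hn => b_eq_sum hn) W₂ r₂ (by linarith) (by linarith)
    (by
      have h : β - 1 - √2 = α - 2 - 2 * √2 := by rw [α]; ring
      rw [h]
      linear_combination γ_sq / 256)
  rw [pB_eq] at l₃ r₃
  rw [pTop_eq] at r₃
  simp only [hdiv] at l₁ l₂ l₃ r₃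
  exact ⟨l₁, l₂, l₃, r₃⟩

theorem g_isEquivalent : (fun n : ℕ => (g n : ℝ)) ~[atTop]
    fun n : ℕ => (16 : ℝ) ^ n / (4 * √Real.pi * (n : ℝ) ^ (3 / 2 : ℝ)) := by
  have h := (IsEquivalent.refl (u := fun n : ℕ => (16 : ℝ) ^ n) (l := atTop)).mul
    scaledTotal_isEquivalent
  refine h.congr_left (Eventually.of_forall fun n => ?_)
  simp only [Pi.mul_apply, scaledTotal]
  field_simp

theorem isEquivalent_of_tendsto_proportion {x : ℕ → ℕ} {p : ℝ} (hp : p ≠ 0)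
    (h : Tendsto (fun n => (x n : ℝ) / g n) atTop (𝓝 p)) :
    (fun n : ℕ => (x n : ℝ)) ~[atTop]
      fun n : ℕ => p / 4 * ((16 : ℝ) ^ n / (√Real.pi * (n : ℝ) ^ (3 / 2 : ℝ))) := by
  have h₁ := ((isEquivalent_const_iff_tendsto hp).2 h).mul g_isEquivalent
  refine (h₁.congr_left ?_).congr_right (Eventually.of_forall fun n => ?_)
  · filter_upwards [eventually_ge_atTop 1] with n hn
    have : (g n : ℝ) ≠ 0 := fun h0 => (scaledTotal_pos n hn).ne' (by rw [scaledTotal, h0, zero_div])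
    exact div_mul_cancel₀ _ this
  · simp only [Pi.mul_apply, Function.const_apply]
    ring

end Godel4

theorem theorem3 :
    (∀ n : ℕ, 1 ≤ n → Godel4.g n = 4 ^ n * catalan (n - 1)) ∧
    ((fun n : ℕ => (Godel4.g n : ℝ)) ~[atTop]
      fun n : ℕ => (16 : ℝ) ^ n / (4 * √Real.pi * (n : ℝ) ^ (3 / 2 : ℝ))) ∧
    (Tendsto (fun n : ℕ => (Godel4.f n : ℝ) / (Godel4.g n : ℝ)) atTop (nhds Godel4.pBot) ∧
      Tendsto (fun n : ℕ => (Godel4.a n : ℝ) / (Godel4.g n : ℝ)) atTop (nhds Godel4.pA) ∧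
      Tendsto (fun n : ℕ => (Godel4.b n : ℝ) / (Godel4.g n : ℝ)) atTop (nhds Godel4.pB) ∧
      Tendsto (fun n : ℕ => (Godel4.t n : ℝ) / (Godel4.g n : ℝ)) atTop (nhds Godel4.pTop)) ∧
    ((fun n : ℕ => (Godel4.f n : ℝ)) ~[atTop]
      fun n : ℕ => Godel4.pBot / 4 * ((16 : ℝ) ^ n / (√Real.pi * (n : ℝ) ^ (3 / 2 : ℝ)))) ∧
    ((fun n : ℕ => (Godel4.a n : ℝ)) ~[atTop]
      fun n : ℕ => Godel4.pA / 4 * ((16 : ℝ) ^ n / (√Real.pi * (n : ℝ) ^ (3 / 2 : ℝ)))) ∧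
    ((fun n : ℕ => (Godel4.b n : ℝ)) ~[atTop]
      fun n : ℕ => Godel4.pB / 4 * ((16 : ℝ) ^ n / (√Real.pi * (n : ℝ) ^ (3 / 2 : ℝ)))) ∧
    ((fun n : ℕ => (Godel4.t n : ℝ)) ~[atTop]
      fun n : ℕ => Godel4.pTop / 4 * ((16 : ℝ) ^ n / (√Real.pi * (n : ℝ) ^ (3 / 2 : ℝ)))) :=
  have ⟨hf, ha, hb, ht⟩ := Godel4.tendsto_proportions
  ⟨fun _ hn => Godel4.g_eq_catalan hn, Godel4.g_isEquivalent, ⟨hf, ha, hb, ht⟩,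
    Godel4.isEquivalent_of_tendsto_proportion Godel4.pBot_pos.ne' hf,
    Godel4.isEquivalent_of_tendsto_proportion Godel4.pA_pos.ne' ha,
    Godel4.isEquivalent_of_tendsto_proportion Godel4.pB_pos.ne' hb,
    Godel4.isEquivalent_of_tendsto_proportion Godel4.pTop_pos.ne' ht⟩
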